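/- A \emph{cone} in a small category $E$ is a tuple $(x,I,\phi,\delta)$ with $x\in\mathrm{ob}\,E$, $I$ a small category, $\phi:I\to E$ a functor and $\delta:*_x\Rightarrow\phi$ a natural transformation from the constant functor at $x$. A \emph{limit sketch} $(E,\{C_\alpha\}_{\alpha\in A})$ is a small category $E$ with a set-indexed family of cones $C_\alpha=(x_\alpha,I_\alpha,\phi_\alpha,\delta_\alpha)$ in $E$ such that each trivial cone $(e,\mathbf 1,*_e,\mathrm{id}_{*_e})$, $e\in\mathrm{ob}\,E$, is one of the $C_\alpha$. A \emph{map of limit sketches} $(E,\{C_\alpha\}_{\alpha\in A})\to(E',\{C'_\beta\}_{\beta\in B})$ is a pair $(F,f)$ of a functor $F:E\to E'$ and a function $f:A\to B$ with $F(C_\alpha)=C'_{f(\alpha)}$ for all $\alpha$ (equality of tuples). A limit sketch is \emph{realized} if every $C_\alpha$ is a limit cone. Let $U:\mathbf{RelLimSk}\to\mathbf{LimSk}$ be the inclusion of the full subcategory of realized limit sketches. Let $(E,\{C_\alpha\}_{\alpha\in A})$ be a limit sketch, $y\in\mathrm{ob}\,E$ and $\alpha\in A$. Let $E[y;\alpha]$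 be the category obtained from $E$ by freely adjoining morphisms $\gamma_i:y\to\phi_\alpha(i)$, $i\in\mathrm{ob}\,I_\alpha$, subject to $\phi_\alpha(f)\circ\gamma_i=\gamma_j$ for $f:i\to j$ in $I_\alpha$; let $E[y;\alpha]'$ be obtained from $E[y;\alpha]$ by freely adjoining a morphism $\bar\gamma:y\to x_\alpha$ subject to $(\delta_\alpha)_i\circ\bar\gamma=\gamma_i$ for all $i$; and let $r_{y,\alpha}:E[y;\alpha]\to E[y;\alpha]'$ be the canonical functor, a morphism of the coslice category $E/\mathbf{Cat}$. Let $\Xi=\{r_{y,\alpha}\}_{y,\alpha}$, let $\mathcal R$ be the class of morphisms of $E/\mathbf{Cat}$ that have the unique right lifting property against every member of $\Xi$, and let $\mathcal L$ be the class of those that have the unique left lifting property against every member of $\mathcal R$. A \emph{fibrant replacement} of $E$ is a factorization $$1_E\xrightarrow{\ \lambda_!(E)\ }\mathrm{fibr}(E)\longrightarrow *$$ of the map from $1_E$ to the terminal object in $E/\mathbf{Cat}$ into a morphism of $\mathcal L$ followed by a morphism of $\mathcal R$; in particular $\lambda_!(E)$ is a functor $E\to\mathrm{fibr}(E)$. \textbf{Theorem.}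 Every limit sketch has a fibrant replacement, and fibrant replacements can be chosen so that $\mathrm{fibr}(E)=E$ and $\lambda_!(E)=1_E$ for every realized limit sketch. For every choice of a fibrant replacement of each limit sketch, $\lambda_!(E)$ is bijective on objects and sends each $C_\alpha$ to a limit cone, and the forgetful functor $U$ has a left adjoint $\mathrm{Fr}:\mathbf{LimSk}\to\mathbf{RelLimSk}$ given on objects by $$\mathrm{Fr}(E,\{C_\alpha\}_{\alpha\in A})=(\mathrm{fibr}(E),\{\lambda_!(E)(C_\alpha)\}_{\alpha\in A}).$$ The component of the unit at $(E,\{C_\alpha\}_{\alpha\in A})$ is $(\lambda_!(E),\mathrm{id}_A)$. The counit is an isomorphism, and if the choice satisfies $\mathrm{fibr}(E)=E$ and $\lambda_!(E)=1_E$ for every realized limit sketch, then $\mathrm{Fr}\,U$ is the identity on objects and every component of the counit is an identity. -/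

import Mathlib

open CategoryTheory CategoryTheory.Limits

universe u v w

/-! ### Cones, limit sketches and their morphisms -/

/-- A cone in `E`, as a tuple `(x, I, φ, δ)`: a small category `I`, a diagram `φ : I ⥤ E`, and a
cone `δ` over `φ` with vertex `x`. -/
structure DiagramCone (E : Type u) [Category.{u} E] where
  shape : Cat.{u, u}
  diagram : shape ⥤ E
  cone : Cone diagram

namespace DiagramCone

variable {E D : Type u} [Category.{u} E] [Category.{u} D]

/-- The image of a cone under a functor. -/
def map (F : E ⥤ D) (c : DiagramCone E) : DiagramCone D where
  shape := c.shape
  diagram := c.diagram ⋙ F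
  cone := F.mapCone c.cone

/-- The cone `(e, 𝟏, *_e, id)` over the constant diagram on the terminal category `𝟏`. -/
def trivial (e : E) : DiagramCone E where
  shape := Cat.of (Discrete PUnit.{u + 1})
  diagram := (Functor.const (Discrete PUnit.{u + 1})).obj e
  cone := { pt := e, π := 𝟙 _ }

/-- The cone is a limit cone. -/
def IsLimitCone (c : DiagramCone E) : Prop := Nonempty (IsLimit c.cone)

theorem map_id (c : DiagramCone E) : c.map (𝟭 E) = c := rfl

theorem map_trivial (F : E ⥤ D) (e : E) : (trivial e).map F = trivial (F.obj e) := by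
  have h : ∀ (G : Discrete PUnit.{u + 1} ⥤ D) (hG : G = (Functor.const _).obj (F.obj e))
      (π : (Functor.const _).obj (F.obj e) ⟶ G), π = eqToHom hG.symm →
      (⟨Cat.of (Discrete PUnit.{u + 1}), G, ⟨F.obj e, π⟩⟩ : DiagramCone D)
        = trivial (F.obj e) := by
    rintro G rfl π rfl
    rfl
  have hG : (Functor.const (Discrete PUnit.{u + 1})).obj e ⋙ F =
      (Functor.const (Discrete PUnit.{u + 1})).obj (F.obj e) :=
    CategoryTheory.Functor.ext (fun _ => rfl) fun _ _ _ => by simp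
  have hπ (j : Discrete PUnit.{u + 1}) : 𝟙 (F.obj e) = (eqToHom hG.symm).app j := by
    rw [eqToHom_app]
    rfl
  exact h _ hG (F.mapCone (trivial e).cone).π
    (NatTrans.ext (funext fun j => (F.map_id e).trans (hπ j)))

end DiagramCone

/-- A (small) limit sketch: a small category with a family of cones indexed by a set, containing
all the trivial cones. -/
structure LimitSketch where
  carrier : Cat.{u, u}
  index : Type u
  cone : index → DiagramCone carrier
  exists_trivial : ∀ e : carrier, ∃ a : index, cone a = DiagramCone.trivial e

namespace LimitSketch

/-- A limit sketch map `(F, f)`: `F` sends the cone with index `α` to the cone with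
index `f α`, where equality of cones is equality of the tuples (vertex, shape, diagram, legs). -/
@[ext]
structure Hom (S T : LimitSketch.{u}) where
  functor : S.carrier ⥤ T.carrier
  onIndex : S.index → T.index
  map_cone : ∀ a, (S.cone a).map functor = T.cone (onIndex a)

/-- The category of limit sketches. -/
instance : Category LimitSketch.{u} where
  Hom := Hom
  id S := ⟨𝟭 _, id, fun _ => rfl⟩
  comp {S T R} p q := ⟨p.functor ⋙ q.functor, q.onIndex ∘ p.onIndex, fun a =>
    (congrArg (DiagramCone.map q.functor) (p.map_cone a)).trans (q.map_cone _)⟩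

/-- A limit sketch is realized if all its specified cones are limit cones. -/
def IsRealized : ObjectProperty LimitSketch.{u} := fun S => ∀ a, (S.cone a).IsLimitCone

end LimitSketch

/-- The full subcategory of realized limit sketches. -/
abbrev RealizedLimitSketch := LimitSketch.IsRealized.{u}.FullSubcategory

/-- The forgetful functor from realized limit sketches to limit sketches. -/
abbrev forgetRealized : RealizedLimitSketch.{u} ⥤ LimitSketch.{u} := LimitSketch.IsRealized.ι

/-! ### Freely adjoining morphisms to a category, subject to relations -/

/-- The objects of a category `C`, carrying the quiver whose edges are the morphisms of `C`
together with the new edges `N`. -/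
structure EdgeExtension (C : Type u) [Category.{u} C] (N : C → C → Type u) where
  as : C

instance (C : Type u) [Category.{u} C] (N : C → C → Type u) : Quiver.{u} (EdgeExtension C N) where
  Hom a b := (a.as ⟶ b.as) ⊕ N a.as b.as

namespace EdgeExtension

variable {C : Type u} [Category.{u} C] (N : C → C → Type u)

/-- An object of `C` in the path category. -/
abbrev vertex (a : C) : Paths (EdgeExtension C N) :=
  (Paths.of (EdgeExtension C N)).obj ⟨a⟩

/-- A morphism of `C` as a path of length one. -/
def old {a b : C} (f : a ⟶ b) : vertex N a ⟶ vertex N b :=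
  (Paths.of (EdgeExtension C N)).map (X := ⟨a⟩) (Y := ⟨b⟩) (Sum.inl f)

/-- A new edge as a path of length one. -/
def new {a b : C} (n : N a b) : vertex N a ⟶ vertex N b :=
  (Paths.of (EdgeExtension C N)).map (X := ⟨a⟩) (Y := ⟨b⟩) (Sum.inr n)

/-- The relations making `old` functorial, together with extra relations `r`. -/
inductive Rel (r : HomRel (Paths (EdgeExtension C N))) : HomRel (Paths (EdgeExtension C N))
  | id (a : C) : Rel r (old N (𝟙 a)) (𝟙 (vertex N a))
  | comp {a b c : C} (f : a ⟶ b) (g : b ⟶ c) : Rel r (old N (f ≫ g)) (old N f ≫ old N g)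
  | of {a b : Paths (EdgeExtension C N)} {p q : a ⟶ b} : r p q → Rel r p q

/-- The category obtained from `C` by freely adjoining the edges `N` and then imposing the
relations `r`: the free category on the extended graph, in which composites and identities
of `C` are identified with those formed in `C` (this is the pushout of the free category on the
extended graph along the counit `Free (U C) ⥤ C`), modulo `r`. -/
abbrev Adjoin (r : HomRel (Paths (EdgeExtension C N))) : Type u :=
  CategoryTheory.Quotient (Rel N r)

variable (r : HomRel (Paths (EdgeExtension C N)))

/-- The canonical functor from `C`. -/
def incl : C ⥤ Adjoin N r where
  obj a := (Quotient.functor (Rel N r)).obj (vertex N a)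
  map f := (Quotient.functor (Rel N r)).map (old N f)
  map_id a := (CategoryTheory.Quotient.sound _ (Rel.id a)).trans
    ((Quotient.functor (Rel N r)).map_id _)
  map_comp f g := (CategoryTheory.Quotient.sound _ (Rel.comp f g)).trans
    ((Quotient.functor (Rel N r)).map_comp _ _)

/-- The morphism given by a new edge. -/
def edge {a b : C} (n : N a b) : (incl N r).obj a ⟶ (incl N r).obj b :=
  (Quotient.functor (Rel N r)).map (new N n)

end EdgeExtension

/-! ### The categories `E[y; α]` and `E[y; α]'` -/

namespace DiagramCone

variable {E : Type u} [Category.{u} E] (y : E) (c : DiagramCone E)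

/-- The new edges `γ_i : y ⟶ φ i`. -/
inductive LegEdge : E → E → Type u
  | leg (i : c.shape) : LegEdge y (c.diagram.obj i)

/-- The relations `φ(f) ∘ γ_i ∼ γ_j` for `f : i ⟶ j`. -/
inductive LegRel : HomRel (Paths (EdgeExtension E (c.LegEdge y)))
  | naturality {i j : c.shape} (f : i ⟶ j) :
      LegRel (EdgeExtension.new (c.LegEdge y) (.leg i) ≫
          EdgeExtension.old (c.LegEdge y) (c.diagram.map f))
        (EdgeExtension.new (c.LegEdge y) (.leg j))

/-- The category `E[y; α]`: `E` with a cone with vertex `y` over the diagram of `c` freely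
adjoined. -/
abbrev WithCone : Type u := EdgeExtension.Adjoin (c.LegEdge y) (c.LegRel y)

/-- The functor `i_{y,α} : E ⥤ E[y; α]`. -/
abbrev toWithCone : E ⥤ c.WithCone y := EdgeExtension.incl (c.LegEdge y) (c.LegRel y)

/-- The adjoined leg `γ_i` in `E[y; α]`. -/
def leg (i : c.shape) :
    (c.toWithCone y).obj y ⟶ (c.toWithCone y).obj (c.diagram.obj i) :=
  EdgeExtension.edge (c.LegEdge y) (c.LegRel y) (.leg i)

/-- The new edge from `y` to the vertex of `c`. -/
inductive LiftEdge : c.WithCone y → c.WithCone y → Type u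
  | lift : LiftEdge ((c.toWithCone y).obj y) ((c.toWithCone y).obj c.cone.pt)

/-- The relations saying that the new edge followed by the `i`-th leg of `c` is `γ_i`. -/
inductive LiftRel : HomRel (Paths (EdgeExtension (c.WithCone y) (c.LiftEdge y)))
  | fac (i : c.shape) :
      LiftRel (EdgeExtension.new (c.LiftEdge y) .lift ≫
          EdgeExtension.old (c.LiftEdge y) ((c.toWithCone y).map (c.cone.π.app i)))
        (EdgeExtension.old (c.LiftEdge y) (c.leg y i))

/-- The category `E[y; α]'`: `E[y; α]` with a factorization of the adjoined cone through `c`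
freely adjoined. -/
abbrev WithLift : Type u := EdgeExtension.Adjoin (c.LiftEdge y) (c.LiftRel y)

/-- The functor `r_{y,α} : E[y; α] ⥤ E[y; α]'`. -/
abbrev toWithLift : c.WithCone y ⥤ c.WithLift y :=
  EdgeExtension.incl (c.LiftEdge y) (c.LiftRel y)

/-- The functor `r_{y,α}` as a morphism of the coslice category `E/Cat`. -/
def generator : Under.mk (c.toWithCone y).toCatHom ⟶
    Under.mk (c.toWithCone y ⋙ c.toWithLift y).toCatHom :=
  Under.homMk (c.toWithLift y).toCatHom rfl

end DiagramCone

/-! ### Unique orthogonality -/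

section Orthogonality

variable {C : Type v} [Category.{w} C]

/-- `f` is uniquely orthogonal to `g`: every commutative square from `f` to `g` has exactly one
lifting. -/
def UniquelyOrthogonal {x y a b : C} (f : x ⟶ y) (g : a ⟶ b) : Prop :=
  ∀ (h : x ⟶ a) (k : y ⟶ b), h ≫ g = f ≫ k → ∃! l : y ⟶ a, f ≫ l = h ∧ l ≫ g = k

/-- The morphisms right orthogonal to all morphisms of `W`. -/
def rightOrthogonal (W : MorphismProperty C) : MorphismProperty C :=
  fun _ _ g => ∀ ⦃x y : C⦄ (f : x ⟶ y), W f → UniquelyOrthogonal f g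

/-- The morphisms left orthogonal to all morphisms of `W`. -/
def leftOrthogonal (W : MorphismProperty C) : MorphismProperty C :=
  fun _ _ f => ∀ ⦃a b : C⦄ (g : a ⟶ b), W g → UniquelyOrthogonal f g

end Orthogonality

/-! ### Fibrant replacement -/

namespace LimitSketch

variable (S : LimitSketch.{u})

/-- The set `Ξ` of morphisms `r_{y,α}` of `E/Cat`, for `y` an object of `E` and `α` an index. -/
def generators : MorphismProperty (Under S.carrier) :=
  .ofHoms fun p : S.carrier × S.index => (S.cone p.2).generator p.1

/-- The right class of the orthogonal factorization system generated by `Ξ`. -/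
def rightClass : MorphismProperty (Under S.carrier) := rightOrthogonal S.generators

/-- The left class of the orthogonal factorization system generated by `Ξ`. -/
def leftClass : MorphismProperty (Under S.carrier) := leftOrthogonal S.rightClass

/-- The morphism from the object `1_E` of `E/Cat` to the terminal object `E ⟶ *`. -/
def toTerminal : Under.mk (𝟙 S.carrier) ⟶
    Under.mk (Y := Cat.of (Discrete PUnit.{u + 1})) (Functor.star S.carrier).toCatHom :=
  Under.homMk (Functor.star S.carrier).toCatHom rfl

/-- A fibrant replacement of `1_E`: a factorization of the terminal map `1_E ⟶ *` in `E/Cat` with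
respect to the orthogonal factorization system generated by `Ξ`. -/
abbrev FibrantReplacement : Type (u + 1) :=
  MorphismProperty.MapFactorizationData S.leftClass S.rightClass S.toTerminal

variable {S}

/-- The category `fibr(E)`, the middle of the factorization. -/
def FibrantReplacement.fibr (K : S.FibrantReplacement) : Cat.{u, u} := K.Z.right

/-- The functor `λ_!(E) : E ⥤ fibr(E)`. -/
def FibrantReplacement.lam (K : S.FibrantReplacement) : S.carrier ⥤ K.fibr := K.i.right.toFunctor

variable (S)

/-- For a functor `F : E ⥤ D` surjective on objects, the limit sketch `(D, {F C_α}_α)`. -/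
def push {D : Cat.{u, u}} (F : S.carrier ⥤ D) (hF : Function.Surjective F.obj) :
    LimitSketch.{u} where
  carrier := D
  index := S.index
  cone a := (S.cone a).map F
  exists_trivial d := by
    obtain ⟨e, rfl⟩ := hF d
    obtain ⟨a, ha⟩ := S.exists_trivial e
    exact ⟨a, by rw [ha, DiagramCone.map_trivial]⟩

/-- The limit sketch map `(F, id) : (E, {C_α}) ⟶ (D, {F C_α})`. -/
def toPush {D : Cat.{u, u}} (F : S.carrier ⥤ D) (hF : Function.Surjective F.obj) :
    S ⟶ S.push F hF :=
  Hom.mk F id fun _ => rfl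

end LimitSketch

/-- The choice of fibrant replacements is normalized if `fibr(E) = E` and `λ_!(E) = 1_E` for
every realized limit sketch; the latter means that `fibr(E)` is the object `1_E` of `E/Cat`. -/
def IsNormalizedReplacement (K : ∀ S : LimitSketch.{u}, S.FibrantReplacement) : Prop :=
  ∀ S : LimitSketch.{u}, S.IsRealized → (K S).Z = Under.mk (𝟙 S.carrier)

/-! An object of `E/Cat`, that is a functor `F : E ⥤ D`, is orthogonal to `Ξ` iff every cone with
vertex `F y` over `F φ_α` factors uniquely through `F C_α` (`isOrthogonalObject_generators_iff`). If
`F` is surjective on objects, this says that each `F C_α` is a limit cone. A fibrant replacement is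
an initial orthogonal object: `1_E` is initial in `E/Cat`, so lifting against `X ⟶ *` gives unique
maps out of it (`existsUnique_hom`). Conversely, an initial orthogonal object yields a
factorization, by a pullback argument (`leftOrthogonal_of_initial`).

Such an object is built from syntax, on the objects of `E`. Expressions are formed by composition
and by formal lifts through the `C_α`. Under an orthogonal `F` an expression has at most one value,
and none if the legs of some lift are incompatible. Morphisms are the expressions that have a value
under every such `F`, identified when all values agree. The quantification over `F` is a
proposition, so the hom-sets stay small, and all identities can be checked on values.

Any replacement is isomorphic under `E` to this one, hence bijective on objects. Its initiality
gives the universal property of `(λ_!(E), id)` and thus the adjunction. -/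

theorem eqToHom_rfl_conj {D : Type v} [Category.{w} D] {a b : D} (f : a ⟶ b) :
    eqToHom rfl ≫ f ≫ eqToHom rfl = f := by
  simp

/-! ### Functors out of a category with freely adjoined morphisms -/

namespace EdgeExtension

variable {C : Type u} [Category.{u} C] {N : C → C → Type u}
  {r : HomRel (Paths (EdgeExtension C N))} {D : Type v} [Category.{w} D]

/-- The functor on paths induced by a functor on `C` and values on the new edges. -/
def pathLift (H : C ⥤ D) (n : ∀ ⦃a b : C⦄, N a b → (H.obj a ⟶ H.obj b)) :
    Paths (EdgeExtension C N) ⥤ D :=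
  Paths.lift
    { obj := fun a => H.obj a.as
      map := fun e => Sum.elim (fun f => H.map f) (fun x => n x) e }

@[simp]
theorem pathLift_old (H : C ⥤ D) (n : ∀ ⦃a b : C⦄, N a b → (H.obj a ⟶ H.obj b))
    {a b : C} (f : a ⟶ b) : (pathLift H n).map (old N f) = H.map f :=
  Paths.lift_toPath _ _

@[simp]
theorem pathLift_new (H : C ⥤ D) (n : ∀ ⦃a b : C⦄, N a b → (H.obj a ⟶ H.obj b))
    {a b : C} (x : N a b) : (pathLift H n).map (new N x) = n x :=
  Paths.lift_toPath _ _

/-- The values `n` on the new edges are compatible with the relations `r`. -/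
def Respects (r : HomRel (Paths (EdgeExtension C N))) (H : C ⥤ D)
    (n : ∀ ⦃a b : C⦄, N a b → (H.obj a ⟶ H.obj b)) : Prop :=
  ∀ ⦃a b : Paths (EdgeExtension C N)⦄ (p q : a ⟶ b), r p q →
    (pathLift H n).map p = (pathLift H n).map q

/-- The functor out of `Adjoin N r` induced by a functor on `C` and values on the new edges
compatible with the relations. -/
def lift (H : C ⥤ D) (n : ∀ ⦃a b : C⦄, N a b → (H.obj a ⟶ H.obj b)) (hn : Respects r H n) :
    Adjoin N r ⥤ D :=
  CategoryTheory.Quotient.lift _ (pathLift H n) (by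
    rintro _ _ _ _ (a | ⟨f, g⟩ | h)
    · exact (pathLift_old H n _).trans ((H.map_id a).trans ((pathLift H n).map_id _).symm)
    · rw [Functor.map_comp]
      simp only [pathLift_old]
      exact H.map_comp f g
    · exact hn _ _ h)

theorem lift_map_edge (H : C ⥤ D) (n : ∀ ⦃a b : C⦄, N a b → (H.obj a ⟶ H.obj b))
    (hn : Respects r H n) {a b : C} (x : N a b) : (lift H n hn).map (edge N r x) = n x :=
  pathLift_new H n x

theorem incl_comp_lift (H : C ⥤ D) (n : ∀ ⦃a b : C⦄, N a b → (H.obj a ⟶ H.obj b))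
    (hn : Respects r H n) : incl N r ⋙ lift H n hn = H :=
  CategoryTheory.Functor.ext (fun _ => rfl) fun _ _ f =>
    (pathLift_old H n f).trans (eqToHom_rfl_conj _).symm

/-- Both functors agree on the generating edges. Hence a functor on the quotient is recovered from
its restriction to `C` and its values on the new edges. -/
theorem pathLift_incl (K : Adjoin N r ⥤ D) :
    pathLift (incl N r ⋙ K) (fun _ _ x => K.map (edge N r x)) =
      CategoryTheory.Quotient.functor (Rel N r) ⋙ K := by
  refine Paths.ext_functor rfl ?_
  rintro a b (f | x)
  · exact (pathLift_old (incl N r ⋙ K) (fun _ _ x => K.map (edge N r x)) f).trans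
      (eqToHom_rfl_conj _).symm
  · exact (pathLift_new (incl N r ⋙ K) (fun _ _ x => K.map (edge N r x)) x).trans
      (eqToHom_rfl_conj _).symm

theorem respects_map_edge (K : Adjoin N r ⥤ D) :
    Respects r (incl N r ⋙ K) (fun _ _ x => K.map (edge N r x)) := by
  intro a b p q h
  rw [pathLift_incl]
  exact congrArg K.map (CategoryTheory.Quotient.sound _ (Rel.of h))

theorem lift_incl_comp (K : Adjoin N r ⥤ D) :
    lift (incl N r ⋙ K) (fun _ _ x => K.map (edge N r x)) (respects_map_edge K) = K := by
  refine CategoryTheory.Quotient.lift_unique' _ _ _ ?_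
  exact (CategoryTheory.Quotient.lift_spec _ _ _).trans (pathLift_incl K)

/-- The universal property of `Adjoin N r`. -/
theorem existsUnique_lift_iff (H : C ⥤ D) :
    (∃! K : Adjoin N r ⥤ D, incl N r ⋙ K = H) ↔
      ∃! n : ∀ ⦃a b : C⦄, N a b → (H.obj a ⟶ H.obj b), Respects r H n := by
  constructor
  · rintro ⟨K, rfl, hK⟩
    refine ⟨_, respects_map_edge K, fun n hn => ?_⟩
    funext a b x
    have h := Functor.congr_hom (hK _ (incl_comp_lift _ n hn)) (edge N r x)
    rw [lift_map_edge] at h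
    exact h.trans (eqToHom_rfl_conj _)
  · rintro ⟨n, hn, h⟩
    refine ⟨lift H n hn, incl_comp_lift H n hn, ?_⟩
    rintro K rfl
    obtain rfl := h _ (respects_map_edge K)
    exact (lift_incl_comp K).symm

end EdgeExtension

/-! ### Functors on `E[y; α]` and `E[y; α]'` as cones and factorizations -/

namespace DiagramCone

variable {E : Type u} [Category.{u} E] {D : Type v} [Category.{w} D]

/-- Every cone with vertex `F y` over the image under `F` of the diagram of `c` factors uniquely
through the image of `c`. -/
def LiftsFrom (c : DiagramCone E) (y : E) (F : E ⥤ D) : Prop :=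
  ∀ m : ∀ i : c.shape, F.obj y ⟶ F.obj (c.diagram.obj i),
    (∀ ⦃i j : c.shape⦄ (f : i ⟶ j), m i ≫ F.map (c.diagram.map f) = m j) →
      ∃! k : F.obj y ⟶ F.obj c.cone.pt, ∀ i, k ≫ F.map (c.cone.π.app i) = m i

variable {c : DiagramCone E} {y : E} {F : E ⥤ D}

theorem leg_comp {i j : c.shape} (f : i ⟶ j) :
    c.leg y i ≫ (c.toWithCone y).map (c.diagram.map f) = c.leg y j :=
  ((CategoryTheory.Quotient.functor _).map_comp _ _).symm.trans
    (CategoryTheory.Quotient.sound _ (EdgeExtension.Rel.of (LegRel.naturality f)))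

/-- The values on the edges `γ_i` given by a family of morphisms. -/
def legValues (m : ∀ i : c.shape, F.obj y ⟶ F.obj (c.diagram.obj i)) :
    ∀ ⦃a b : E⦄, c.LegEdge y a b → (F.obj a ⟶ F.obj b)
  | _, _, .leg i => m i

theorem respects_legValues {m : ∀ i : c.shape, F.obj y ⟶ F.obj (c.diagram.obj i)}
    (hm : ∀ ⦃i j : c.shape⦄ (f : i ⟶ j), m i ≫ F.map (c.diagram.map f) = m j) :
    EdgeExtension.Respects (c.LegRel y) F (legValues m) := by
  rintro _ _ _ _ ⟨f⟩
  rw [Functor.map_comp]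
  simp only [EdgeExtension.pathLift_old, EdgeExtension.pathLift_new]
  exact hm f

/-- The functor on `E[y; α]` induced by a functor on `E` and a cone with vertex the image
of `y`. -/
def withConeLift (m : ∀ i : c.shape, F.obj y ⟶ F.obj (c.diagram.obj i))
    (hm : ∀ ⦃i j : c.shape⦄ (f : i ⟶ j), m i ≫ F.map (c.diagram.map f) = m j) :
    c.WithCone y ⥤ D :=
  EdgeExtension.lift F (legValues m) (respects_legValues hm)

theorem withConeLift_leg (m : ∀ i : c.shape, F.obj y ⟶ F.obj (c.diagram.obj i))
    (hm : ∀ ⦃i j : c.shape⦄ (f : i ⟶ j), m i ≫ F.map (c.diagram.map f) = m j) (i : c.shape) :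
    (withConeLift m hm).map (c.leg y i) = m i :=
  EdgeExtension.lift_map_edge _ _ _ _

theorem toWithCone_comp_withConeLift (m : ∀ i : c.shape, F.obj y ⟶ F.obj (c.diagram.obj i))
    (hm : ∀ ⦃i j : c.shape⦄ (f : i ⟶ j), m i ≫ F.map (c.diagram.map f) = m j) :
    c.toWithCone y ⋙ withConeLift m hm = F :=
  EdgeExtension.incl_comp_lift _ _ _

/-- The values on the new edge of `E[y; α]'` given by a morphism. -/
def liftValues {H : c.WithCone y ⥤ D}
    (k : H.obj ((c.toWithCone y).obj y) ⟶ H.obj ((c.toWithCone y).obj c.cone.pt)) :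
    ∀ ⦃a b : c.WithCone y⦄, c.LiftEdge y a b → (H.obj a ⟶ H.obj b)
  | _, _, .lift => k

theorem respects_liftEdge_iff {H : c.WithCone y ⥤ D}
    (n : ∀ ⦃a b : c.WithCone y⦄, c.LiftEdge y a b → (H.obj a ⟶ H.obj b)) :
    EdgeExtension.Respects (c.LiftRel y) H n ↔
      ∀ i, n .lift ≫ H.map ((c.toWithCone y).map (c.cone.π.app i)) = H.map (c.leg y i) := by
  constructor
  · intro h i
    have := h _ _ (LiftRel.fac i)
    rw [Functor.map_comp] at this
    simp only [EdgeExtension.pathLift_old, EdgeExtension.pathLift_new] at this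
    exact this
  · rintro h _ _ _ _ ⟨i⟩
    rw [Functor.map_comp]
    simp only [EdgeExtension.pathLift_old, EdgeExtension.pathLift_new]
    exact h i

/-- There is only one new edge, so a family of values on new edges amounts to a single morphism `k`.
-/
theorem existsUnique_toWithLift_iff (H : c.WithCone y ⥤ D) :
    (∃! K : c.WithLift y ⥤ D, c.toWithLift y ⋙ K = H) ↔
      ∃! k : H.obj ((c.toWithCone y).obj y) ⟶ H.obj ((c.toWithCone y).obj c.cone.pt),
        ∀ i, k ≫ H.map ((c.toWithCone y).map (c.cone.π.app i)) = H.map (c.leg y i) := by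
  rw [EdgeExtension.existsUnique_lift_iff]
  simp only [respects_liftEdge_iff]
  constructor
  · rintro ⟨n, hn, h⟩
    exact ⟨n .lift, hn, fun k hk => by rw [← h (liftValues k) hk]; rfl⟩
  · rintro ⟨k, hk, h⟩
    refine ⟨liftValues k, hk, fun n hn => ?_⟩
    funext _ _ x
    cases x
    exact h _ hn

/-- Extensions of `F` to `E[y; α]` are the compatible families `m`; extending further to `E[y; α]'`
means choosing a factorization `k`. -/
theorem liftsFrom_iff :
    c.LiftsFrom y F ↔ ∀ H : c.WithCone y ⥤ D, c.toWithCone y ⋙ H = F →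
      ∃! K : c.WithLift y ⥤ D, c.toWithLift y ⋙ K = H := by
  constructor
  · rintro hF H rfl
    rw [existsUnique_toWithLift_iff]
    refine hF (fun i => H.map (c.leg y i)) fun i j f => ?_
    rw [Functor.comp_map, ← H.map_comp, leg_comp]
  · intro h m hm
    have := h (withConeLift m hm) (toWithCone_comp_withConeLift m hm)
    rw [existsUnique_toWithLift_iff] at this
    simp only [withConeLift_leg] at this
    have hmap (i : c.shape) : (withConeLift m hm).map ((c.toWithCone y).map (c.cone.π.app i)) =
        F.map (c.cone.π.app i) := EdgeExtension.pathLift_old _ _ _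
    simp only [hmap] at this
    exact this

end DiagramCone

/-! ### Orthogonal objects and the left class -/

section Orthogonality

variable {C : Type v} [Category.{w} C]

/-- The object `z` is orthogonal to all morphisms of `W`. -/
def IsOrthogonalObject (W : MorphismProperty C) (z : C) : Prop :=
  ∀ ⦃x y : C⦄ (f : x ⟶ y), W f → ∀ h : x ⟶ z, ∃! l : y ⟶ z, f ≫ l = h

/-- Over a terminal object the square and the lower triangle commute automatically. -/
theorem rightOrthogonal_iff_of_isTerminal {W : MorphismProperty C} {z t : C} (ht : IsTerminal t)
    (p : z ⟶ t) : rightOrthogonal W p ↔ IsOrthogonalObject W z := by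
  refine forall_congr' fun x => forall_congr' fun y => forall_congr' fun f =>
    forall_congr' fun _ => ⟨fun H h => ?_, fun H h k _ => ?_⟩
  · simpa [ht.hom_ext (_ ≫ p) (ht.from y)] using H h (ht.from y) (ht.hom_ext _ _)
  · simpa [ht.hom_ext (_ ≫ p) k] using H h

theorem leftOrthogonal_of_isIso (W : MorphismProperty C) {x y : C} (f : x ⟶ y) [IsIso f] :
    leftOrthogonal W f := fun _ _ g _ h k hk =>
  ⟨inv f ≫ h, ⟨by simp, by simp [hk]⟩, fun l hl => by simp [← hl.1]⟩

/-- A morphism from an initial object to an initial orthogonal object is left orthogonal to the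
right class. -/
theorem leftOrthogonal_of_initial [HasPullbacks C] {W : MorphismProperty C} {e z : C}
    (he : IsInitial e) (i : e ⟶ z) (hz : IsOrthogonalObject W z)
    (hinit : ∀ d, IsOrthogonalObject W d → ∃! _ : z ⟶ d, True) :
    leftOrthogonal (rightOrthogonal W) i := by
  intro a b g hg h k _
  have hext {d : C} (hd : IsOrthogonalObject W d) (s t : z ⟶ d) : s = t :=
    (hinit d hd).unique trivial trivial
  -- The projection to `z` is a base change of `g`, and `z` is orthogonal: first lift into `z`, then
  -- use that lift as the bottom map of a square to `g`.
  have hP : IsOrthogonalObject W (pullback g k) := by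
    intro x y f hf q
    obtain ⟨l₂, hl₂, hu₂⟩ := hz f hf (q ≫ pullback.snd g k)
    obtain ⟨l₁, ⟨hl₁, hl₁'⟩, hu₁⟩ := hg f hf (q ≫ pullback.fst g k) (l₂ ≫ k) (by
      rw [Category.assoc, pullback.condition, ← Category.assoc, ← hl₂, Category.assoc])
    refine ⟨pullback.lift l₁ l₂ hl₁', ?_, fun l hl => ?_⟩
    · apply pullback.hom_ext
      · rw [Category.assoc, pullback.lift_fst, hl₁]
      · rw [Category.assoc, pullback.lift_snd, hl₂]
    have h₂ : l ≫ pullback.snd g k = l₂ := hu₂ _ (by simp [← hl])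
    have h₁ : l ≫ pullback.fst g k = l₁ := hu₁ _ ⟨by simp [← hl], by
      rw [Category.assoc, pullback.condition, ← Category.assoc, h₂]⟩
    apply pullback.hom_ext
    · rw [pullback.lift_fst, h₁]
    · rw [pullback.lift_snd, h₂]
  -- Initiality of `z` makes `s` a section of the projection to `z`. Liftings of the square
  -- correspond to such sections, and `s` is the only one.
  obtain ⟨s, -, -⟩ := hinit _ hP
  refine ⟨s ≫ pullback.fst g k, ⟨he.hom_ext _ _, ?_⟩, ?_⟩
  · rw [Category.assoc, pullback.condition, ← Category.assoc,
      hext hz (s ≫ pullback.snd g k) (𝟙 z), Category.id_comp]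
  · rintro l ⟨-, hl⟩
    rw [hext hP s (pullback.lift l (𝟙 z) (by simp [hl])), pullback.lift_fst]

end Orthogonality

/-! ### Orthogonality to `Ξ` and limit cones -/

namespace LimitSketch

variable (S : LimitSketch.{u})

/-- The functor `F` sends the cones of `S` to cones that are limit cones as far as cones with
vertex in the image of `F` are concerned. -/
def Lifts {D : Type v} [Category.{w} D] (F : S.carrier ⥤ D) : Prop :=
  ∀ a y, (S.cone a).LiftsFrom y F

theorem isOrthogonalObject_generators_iff (X : Under S.carrier) :
    IsOrthogonalObject S.generators X ↔ S.Lifts X.hom.toFunctor := by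
  have key (a : S.index) (y : S.carrier) :
      (∀ h : Under.mk ((S.cone a).toWithCone y).toCatHom ⟶ X,
        ∃! l, (S.cone a).generator y ≫ l = h) ↔ (S.cone a).LiftsFrom y X.hom.toFunctor := by
    rw [DiagramCone.liftsFrom_iff]
    constructor
    · intro H G hG
      obtain ⟨l, hl, hu⟩ := H (Under.homMk G.toCatHom (Cat.Hom.ext hG))
      refine ⟨l.right.toFunctor, congrArg (fun t => t.right.toFunctor) hl, fun K hK => ?_⟩
      have := hu (Under.homMk K.toCatHom (Cat.Hom.ext (by
        refine Eq.trans ?_ hG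
        rw [← hK]
        rfl))) (Under.UnderMorphism.ext (Cat.Hom.ext hK))
      exact congrArg (fun t => t.right.toFunctor) this
    · intro H h
      have hh : (S.cone a).toWithCone y ⋙ h.right.toFunctor = X.hom.toFunctor :=
        congrArg (fun t => t.toFunctor) (Under.w h)
      obtain ⟨K, hK, hu⟩ := H h.right.toFunctor hh
      refine ⟨Under.homMk K.toCatHom (Cat.Hom.ext (by
        refine Eq.trans ?_ hh
        rw [← hK]
        rfl)), Under.UnderMorphism.ext (Cat.Hom.ext hK), fun l hl => ?_⟩
      exact Under.UnderMorphism.ext (Cat.Hom.ext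
        (hu l.right.toFunctor (congrArg (fun t => t.right.toFunctor) hl)))
  constructor
  · exact fun H a y => (key a y).1 (H _ ⟨(y, a)⟩)
  · rintro H _ _ _ ⟨y, a⟩
    exact (key a y).2 (H a y)

/-- The functor to the terminal category is terminal in `E/Cat`. -/
def isTerminalStar : IsTerminal
    (Under.mk (Y := Cat.of (Discrete PUnit.{u + 1})) (Functor.star S.carrier).toCatHom) :=
  IsTerminal.ofUniqueHom
    (fun X => Under.homMk (Functor.star X.right).toCatHom
      (Cat.Hom.ext (Functor.punit_ext' _ _)))
    fun _ _ => Under.UnderMorphism.ext (Cat.Hom.ext (Functor.punit_ext' _ _))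

/-- `LiftsFrom` tests only vertices of the form `F y`; surjectivity on objects makes these all the
vertices. -/
theorem isLimitCone_map_iff {D : Type u} [Category.{u} D] {E : Type u} [Category.{u} E]
    (F : E ⥤ D) (hF : Function.Surjective F.obj) (c : DiagramCone E) :
    (c.map F).IsLimitCone ↔ ∀ y, c.LiftsFrom y F := by
  constructor
  · rintro ⟨h⟩ y m hm
    let s : Cone (c.diagram ⋙ F) :=
      { pt := F.obj y
        π := { app := m, naturality := fun i j f => by simpa using (hm f).symm } }
    exact ⟨h.lift s, h.fac s, h.uniq s⟩
  · intro h
    have H (s : Cone (c.diagram ⋙ F)) :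
        ∃! k : s.pt ⟶ F.obj c.cone.pt, ∀ i, k ≫ F.map (c.cone.π.app i) = s.π.app i := by
      obtain ⟨y, hy⟩ := hF s.pt
      obtain ⟨pt, π⟩ := s
      subst hy
      exact h y (fun i => π.app i) fun i j f => by simpa using (π.naturality f).symm
    exact ⟨IsLimit.ofExistsUnique H⟩

theorem isRealized_push_iff {D : Cat.{u, u}} (F : S.carrier ⥤ D)
    (hF : Function.Surjective F.obj) : (S.push F hF).IsRealized ↔ S.Lifts F :=
  forall_congr' fun a => isLimitCone_map_iff F hF (S.cone a)

theorem isRealized_iff : S.IsRealized ↔ S.Lifts (𝟭 S.carrier) :=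
  S.isRealized_push_iff (𝟭 S.carrier) Function.surjective_id

variable {S} in
-- No surjectivity is needed here: the image of each cone is a specified cone of `T`, hence a limit
-- cone.
theorem IsRealized.lifts_functor {T : LimitSketch.{u}} (hT : T.IsRealized) (G : S ⟶ T) :
    S.Lifts (Hom.functor G) := by
  intro a y m hm
  have h := hT (Hom.onIndex G a)
  rw [← Hom.map_cone G a] at h
  obtain ⟨h⟩ := h
  let s : Cone ((S.cone a).diagram ⋙ Hom.functor G) :=
    { pt := (Hom.functor G).obj y
      π := { app := m, naturality := fun i j f => by simpa using (hm f).symm } }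
  exact ⟨h.lift s, h.fac s, h.uniq s⟩

end LimitSketch

/-! ### Expressions and their values -/

namespace LimitSketch

variable (S : LimitSketch.{u})

/-- Formal expressions for morphisms, built from morphisms of the sketch by composition and by
lifting families of expressions through the specified cones. -/
inductive Term : S.carrier → S.carrier → Type u
  | of {x y : S.carrier} (f : x ⟶ y) : Term x y
  | comp {x y z : S.carrier} (s : Term x y) (t : Term y z) : Term x z
  | lift {y : S.carrier} (a : S.index)
      (legs : ∀ i : (S.cone a).shape, Term y ((S.cone a).diagram.obj i)) :
      Term y (S.cone a).cone.pt

variable {S}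

namespace Term

section Eval

variable {D : Type v} [Category.{w} D]

/-- The morphism `m` is a value of the expression `t` under the functor `F`. -/
def Eval (F : S.carrier ⥤ D) : ∀ {x y : S.carrier}, S.Term x y → (F.obj x ⟶ F.obj y) → Prop
  | _, _, of f, m => m = F.map f
  | _, _, comp s t, m => ∃ p q, Eval F s p ∧ Eval F t q ∧ m = p ≫ q
  | _, _, lift a legs, m =>
      ∀ i, Eval F (legs i) (m ≫ F.map ((S.cone a).cone.π.app i))

theorem Eval.unique {F : S.carrier ⥤ D} (hF : S.Lifts F) {x y : S.carrier} {t : S.Term x y}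
    {m n : F.obj x ⟶ F.obj y} (hm : t.Eval F m) (hn : t.Eval F n) : m = n := by
  induction t with
  | of f => exact Eq.trans hm (Eq.symm hn)
  | comp s t hs ht =>
    obtain ⟨p, q, hp, hq, rfl⟩ := hm
    obtain ⟨p', q', hp', hq', rfl⟩ := hn
    rw [hs hp hp', ht hq hq']
  | @lift z a legs ih =>
    -- The projections of `m` form a compatible family, and by induction `n` has the same
    -- projections, so both factor this family.
    refine (hF a z (fun i => m ≫ F.map ((S.cone a).cone.π.app i)) fun i j f => ?_).unique
      (fun i => rfl) fun i => ih i (hn i) (hm i)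
    rw [Category.assoc, ← F.map_comp, (S.cone a).cone.w]

end Eval

/-- Two expressions have a common value under every functor `F` with `S.Lifts F`. -/
def Rel {x y : S.carrier} (s t : S.Term x y) : Prop :=
  ∀ (D : Type u) [Category.{u} D] (F : S.carrier ⥤ D), S.Lifts F → ∃ m, s.Eval F m ∧ t.Eval F m

theorem Rel.symm {x y : S.carrier} {s t : S.Term x y} (h : s.Rel t) : t.Rel s := fun D _ F hF =>
  let ⟨m, hs, ht⟩ := h D F hF
  ⟨m, ht, hs⟩

/-- Uniqueness of values identifies the two values of the middle expression. -/
theorem Rel.trans {x y : S.carrier} {r s t : S.Term x y} (h : r.Rel s) (h' : s.Rel t) :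
    r.Rel t := fun D _ F hF => by
  obtain ⟨m, hr, hs⟩ := h D F hF
  obtain ⟨n, hs', ht⟩ := h' D F hF
  obtain rfl := hs.unique hF hs'
  exact ⟨m, hr, ht⟩

theorem Rel.comp {x y z : S.carrier} {s s' : S.Term x y} {t t' : S.Term y z} (h : s.Rel s')
    (h' : t.Rel t') : (s.comp t).Rel (s'.comp t') := fun D _ F hF => by
  obtain ⟨m, hs, hs'⟩ := h D F hF
  obtain ⟨n, ht, ht'⟩ := h' D F hF
  exact ⟨m ≫ n, ⟨m, n, hs, ht, rfl⟩, ⟨m, n, hs', ht', rfl⟩⟩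

theorem rel_of {x y : S.carrier} (f : x ⟶ y) : (of (S := S) f).Rel (of f) :=
  fun _ _ F _ => ⟨F.map f, rfl, rfl⟩

/-- The equivalence of expressions that have a value under every `F` with `S.Lifts F`. -/
instance setoid (x y : S.carrier) : Setoid {t : S.Term x y // t.Rel t} where
  r s t := s.1.Rel t.1
  iseqv := ⟨fun t => t.2, Rel.symm, Rel.trans⟩

end Term

/-! ### The free category and its universal property -/

variable (S) in
/-- The objects of the sketch `S`, as objects of the free category with limits of the specified
cones. -/
structure Free where
  as : S.carrier

namespace Free

/-- Morphisms of the free category: expressions up to equality of their values. -/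
def Hom (x y : S.Free) : Type u := Quotient (Term.setoid x.as y.as)

/-- The morphism given by an expression. -/
def Hom.mk {x y : S.carrier} (t : S.Term x y) (ht : t.Rel t) : Hom ⟨x⟩ ⟨y⟩ := ⟦⟨t, ht⟩⟧

section Value

variable {D : Type u} [Category.{u} D] (F : S.carrier ⥤ D) (hF : S.Lifts F)

/-- The value of a morphism of the free category under a functor `F` with `S.Lifts F`. -/
noncomputable def value {x y : S.Free} (f : Hom x y) : F.obj x.as ⟶ F.obj y.as :=
  Quotient.lift (fun t => (t.2 D F hF).choose) (fun s t h => by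
    obtain ⟨m, hs, ht⟩ := h D F hF
    rw [Term.Eval.unique hF (s.2 D F hF).choose_spec.1 hs,
      Term.Eval.unique hF (t.2 D F hF).choose_spec.1 ht]) f

variable {x y : S.carrier}

theorem eval_value {t : S.Term x y} (ht : t.Rel t) : t.Eval F (value F hF (Hom.mk t ht)) :=
  (ht D F hF).choose_spec.1

theorem value_mk_eq {t : S.Term x y} (ht : t.Rel t) {m : F.obj x ⟶ F.obj y}
    (hm : t.Eval F m) : value F hF (Hom.mk t ht) = m :=
  (eval_value F hF ht).unique hF hm

end Value

/-- Expressions are identified by their values, so values separate morphisms; the category laws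
reduce to those of each `D`. -/
theorem hom_ext {x y : S.Free} {f g : Hom x y}
    (h : ∀ (D : Type u) [Category.{u} D] (F : S.carrier ⥤ D) (hF : S.Lifts F),
      value F hF f = value F hF g) : f = g := by
  obtain ⟨s, rfl⟩ := Quotient.exists_rep f
  obtain ⟨t, rfl⟩ := Quotient.exists_rep g
  exact Quotient.sound fun D _ F hF =>
    ⟨_, eval_value F hF s.2, by erw [h D F hF]; exact eval_value F hF t.2⟩

instance : CategoryStruct S.Free where
  Hom := Hom
  id x := Hom.mk (.of (𝟙 x.as)) (Term.rel_of _)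
  comp f g := Quotient.map₂ (fun s t => ⟨s.1.comp t.1, s.2.comp t.2⟩)
    (fun _ _ h _ _ h' => Term.Rel.comp h h') f g

section Value

variable {D : Type u} [Category.{u} D] (F : S.carrier ⥤ D) (hF : S.Lifts F)

theorem value_id (x : S.Free) : value F hF (𝟙 x) = 𝟙 (F.obj x.as) :=
  value_mk_eq F hF _ (F.map_id _).symm

theorem value_comp {x y z : S.Free} (f : x ⟶ y) (g : y ⟶ z) :
    value F hF (f ≫ g) = value F hF f ≫ value F hF g := by
  obtain ⟨s, rfl⟩ := Quotient.exists_rep f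
  obtain ⟨t, rfl⟩ := Quotient.exists_rep g
  exact value_mk_eq F hF (s.2.comp t.2) ⟨_, _, eval_value F hF s.2, eval_value F hF t.2, rfl⟩

end Value

instance : Category.{u} S.Free where
  id_comp f := hom_ext fun D _ F hF => by rw [value_comp, value_id, Category.id_comp]
  comp_id f := hom_ext fun D _ F hF => by rw [value_comp, value_id, Category.comp_id]
  assoc f g h := hom_ext fun D _ F hF => by simp only [value_comp, Category.assoc]

variable (S) in
/-- The canonical functor to the free category. -/
def ι : S.carrier ⥤ S.Free where
  obj x := ⟨x⟩
  map f := Hom.mk (.of f) (Term.rel_of f)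
  map_comp f g :=
    Quotient.sound fun _ _ F _ => ⟨F.map (f ≫ g), rfl, _, _, rfl, rfl, F.map_comp f g⟩

theorem bijective_ι_obj : Function.Bijective (ι S).obj :=
  ⟨fun _ _ h => congrArg as h, fun x => ⟨x.as, rfl⟩⟩

section Desc

variable {D : Type u} [Category.{u} D] (F : S.carrier ⥤ D) (hF : S.Lifts F)

theorem value_ι {x y : S.carrier} (f : x ⟶ y) : value F hF ((ι S).map f) = F.map f :=
  value_mk_eq F hF _ rfl

theorem value_comp_ι {x y z : S.carrier} (f : (ι S).obj x ⟶ (ι S).obj y) (g : y ⟶ z) :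
    value F hF (x := ⟨x⟩) (y := ⟨z⟩) (f ≫ (ι S).map g) =
      value F hF (x := ⟨x⟩) (y := ⟨y⟩) f ≫ F.map g :=
  (value_comp F hF f _).trans (congrArg _ (value_ι F hF g))

/-- The functor on the free category induced by a functor `F` with `S.Lifts F`. -/
noncomputable def desc : S.Free ⥤ D where
  obj x := F.obj x.as
  map f := value F hF f
  map_id := value_id F hF
  map_comp := value_comp F hF

theorem ι_comp_desc : ι S ⋙ desc F hF = F :=
  CategoryTheory.Functor.ext (fun _ => rfl) fun _ _ f =>
    (value_ι F hF f).trans (eqToHom_rfl_conj _).symm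

end Desc

/-- Choose expressions for the given legs and form their formal lift. Under each `F` the values of
the legs are compatible, so `hF` supplies a value of the lift; factorization and uniqueness are then
checked on values. -/
theorem lifts_ι : S.Lifts (ι S) := by
  intro a y m hm
  choose t ht using fun i => Quotient.exists_rep (m i)
  have hm' {D : Type u} [Category.{u} D] (F : S.carrier ⥤ D) (hF : S.Lifts F) :=
    hF a y (fun i => value F hF (m i)) fun i j f =>
      (value_comp_ι F hF (m i) _).symm.trans (congrArg _ (hm f))
  have heval {D : Type u} [Category.{u} D] (F : S.carrier ⥤ D) (hF : S.Lifts F)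
      (k : F.obj y ⟶ F.obj (S.cone a).cone.pt)
      (hk : ∀ i, k ≫ F.map ((S.cone a).cone.π.app i) = value F hF (m i)) :
      (Term.lift a fun i => (t i).1).Eval F k := fun i => by
    have h := eval_value F hF (t i).2
    rwa [show Hom.mk _ (t i).2 = m i from ht i, ← hk i] at h
  -- The formal lift has a value everywhere, hence represents a morphism.
  have hrel : (Term.lift a fun i => (t i).1).Rel (.lift a fun i => (t i).1) :=
    fun D _ F hF => by
      obtain ⟨k, hk, -⟩ := hm' F hF
      exact ⟨k, heval F hF k hk, heval F hF k hk⟩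
  refine ⟨Hom.mk _ hrel, fun i => hom_ext fun D _ F hF => ?_,
    fun k hk => hom_ext fun D _ F hF => ?_⟩
  · obtain ⟨k, hk, -⟩ := hm' F hF
    refine (value_comp_ι F hF (Hom.mk _ hrel) _).trans (Eq.trans ?_ (hk i))
    exact congrArg (· ≫ _) (value_mk_eq F hF hrel (heval F hF k hk))
  · refine (value_mk_eq F hF _ (heval F hF (value F hF k) fun i => ?_)).symm
    exact (value_comp_ι F hF k _).symm.trans (congrArg _ (hk i))

section Uniqueness

variable {D : Type u} [Category.{u} D]

/-- This gives uniqueness of `desc`: `G` must send the class of `t` to a value of `t`. The induction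
works because subexpressions of an everywhere defined expression are everywhere defined. -/
theorem eval_map (G : S.Free ⥤ D) {x y : S.carrier} (t : S.Term x y) (ht : t.Rel t) :
    t.Eval (ι S ⋙ G) (G.map (Hom.mk t ht : (ι S).obj x ⟶ (ι S).obj y)) := by
  induction t with
  | of f => rfl
  | @comp x y z s t hs ht' =>
    have h₁ : s.Rel s := fun D _ F hF =>
      let ⟨_, ⟨p, _, hp, _⟩, _⟩ := ht D F hF
      ⟨p, hp, hp⟩
    have h₂ : t.Rel t := fun D _ F hF =>
      let ⟨_, ⟨_, q, _, hq, _⟩, _⟩ := ht D F hF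
      ⟨q, hq, hq⟩
    exact ⟨_, _, hs h₁, ht' h₂, G.map_comp (X := (ι S).obj x) (Y := (ι S).obj y)
      (Z := (ι S).obj z) (Hom.mk s h₁) (Hom.mk t h₂)⟩
  | @lift y a legs ih =>
    intro i
    have h : (legs i).Rel (legs i) := fun D _ F hF =>
      let ⟨_, hm, _⟩ := ht D F hF
      ⟨_, hm i, hm i⟩
    -- The formal lift followed by the `i`-th projection equals its `i`-th leg, as their values
    -- show.
    have heq : (Hom.mk _ ht : (ι S).obj y ⟶ (ι S).obj (S.cone a).cone.pt) ≫
        (ι S).map ((S.cone a).cone.π.app i) = Hom.mk _ h := hom_ext fun D _ F hF =>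
      (value_comp_ι F hF (Hom.mk _ ht) _).trans
        (value_mk_eq F hF h (eval_value F hF ht i)).symm
    have hmap := (G.map_comp (Hom.mk _ ht : (ι S).obj y ⟶ (ι S).obj (S.cone a).cone.pt)
      ((ι S).map ((S.cone a).cone.π.app i))).symm.trans (congrArg G.map heq)
    exact (congrArg (Term.Eval (ι S ⋙ G) (legs i)) hmap).mpr (ih i h)

theorem desc_ι_comp (G : S.Free ⥤ D) (hG : S.Lifts (ι S ⋙ G)) : desc (ι S ⋙ G) hG = G := by
  refine CategoryTheory.Functor.ext (fun _ => rfl) fun x y f => ?_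
  refine Eq.trans ?_ (eqToHom_rfl_conj _).symm
  obtain ⟨t, rfl⟩ := Quotient.exists_rep f
  exact value_mk_eq (ι S ⋙ G) hG t.2 (eval_map G t.1 t.2)

end Uniqueness

end Free

end LimitSketch

/-! ### Existence of fibrant replacements -/

namespace LimitSketch

variable (S : LimitSketch.{u})

/-- The free category as an object of `E/Cat`. -/
def freeUnder : Under S.carrier := Under.mk (Y := Cat.of S.Free) (Free.ι S).toCatHom

theorem isOrthogonalObject_freeUnder : IsOrthogonalObject S.generators S.freeUnder :=
  (S.isOrthogonalObject_generators_iff _).2 Free.lifts_ι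

theorem existsUnique_freeUnder_hom (X : Under S.carrier)
    (hX : IsOrthogonalObject S.generators X) : ∃! _ : S.freeUnder ⟶ X, True := by
  rw [isOrthogonalObject_generators_iff] at hX
  refine ⟨Under.homMk (Free.desc X.hom.toFunctor hX).toCatHom
    (Cat.Hom.ext (Free.ι_comp_desc X.hom.toFunctor hX)), trivial, fun f _ => ?_⟩
  refine Under.UnderMorphism.ext (Cat.Hom.ext ?_)
  have hf : Free.ι S ⋙ f.right.toFunctor = X.hom.toFunctor :=
    congrArg (fun t => t.toFunctor) (Under.w f)
  -- The functor is generalized so that the equation `hf` can be substituted.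
  have key : ∀ (F : S.carrier ⥤ X.right) (hF : S.Lifts F),
      Free.ι S ⋙ f.right.toFunctor = F → f.right.toFunctor = Free.desc F hF := by
    rintro _ hF rfl
    exact (Free.desc_ι_comp _ hF).symm
  exact key _ hX hf

/-- The fibrant replacement given by the free category. -/
noncomputable def freeReplacement : S.FibrantReplacement where
  Z := S.freeUnder
  i := Under.mkIdInitial.to _
  p := S.isTerminalStar.from _
  fac := S.isTerminalStar.hom_ext _ _
  hi := leftOrthogonal_of_initial Under.mkIdInitial _ S.isOrthogonalObject_freeUnder
    S.existsUnique_freeUnder_hom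
  hp := (rightOrthogonal_iff_of_isTerminal S.isTerminalStar _).2 S.isOrthogonalObject_freeUnder

/-- The trivial fibrant replacement of a realized sketch. -/
def IsRealized.replacement (hS : S.IsRealized) : S.FibrantReplacement where
  Z := Under.mk (𝟙 S.carrier)
  i := 𝟙 _
  p := S.toTerminal
  fac := Category.id_comp _
  hi := leftOrthogonal_of_isIso _ _
  hp := (rightOrthogonal_iff_of_isTerminal S.isTerminalStar _).2
    ((S.isOrthogonalObject_generators_iff _).2 (S.isRealized_iff.1 hS))

theorem exists_normalized_replacement :
    ∃ K : ∀ S : LimitSketch.{u}, S.FibrantReplacement, IsNormalizedReplacement K := by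
  classical
  refine ⟨fun S => if h : S.IsRealized then IsRealized.replacement S h else S.freeReplacement,
    fun S hS => ?_⟩
  simp only [dif_pos hS]
  rfl

/-! ### Properties of an arbitrary fibrant replacement -/

namespace FibrantReplacement

variable {S} (K : S.FibrantReplacement)

theorem isOrthogonalObject : IsOrthogonalObject S.generators K.Z :=
  (rightOrthogonal_iff_of_isTerminal S.isTerminalStar _).1 K.hp

/-- Lift the left-class map `1_E ⟶ K.Z` against `X ⟶ *`, which is in the right class; initiality of
`1_E` and terminality of `*` make every condition automatic. -/
theorem existsUnique_hom (X : Under S.carrier) (hX : IsOrthogonalObject S.generators X) :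
    ∃! _ : K.Z ⟶ X, True := by
  obtain ⟨l, -, hl⟩ := K.hi (S.isTerminalStar.from X)
    ((rightOrthogonal_iff_of_isTerminal S.isTerminalStar _).2 hX)
    (Under.mkIdInitial.to X) (S.isTerminalStar.from _) (S.isTerminalStar.hom_ext _ _)
  exact ⟨l, trivial, fun k _ =>
    hl k ⟨Under.mkIdInitial.hom_ext _ _, S.isTerminalStar.hom_ext _ _⟩⟩

theorem hom_toFunctor_eq_lam : K.Z.hom.toFunctor = K.lam := by
  have h := Under.w K.i
  rw [← h]
  exact Functor.id_comp _

theorem lifts_lam : S.Lifts K.lam := by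
  rw [← hom_toFunctor_eq_lam]
  exact (S.isOrthogonalObject_generators_iff _).1 K.isOrthogonalObject

/-- Two initial orthogonal objects are isomorphic under `E`, and `Free.ι` is bijective on objects.
-/
theorem bijective_lam_obj : Function.Bijective K.lam.obj := by
  obtain ⟨f, -, -⟩ := K.existsUnique_hom _ S.isOrthogonalObject_freeUnder
  obtain ⟨g, -, -⟩ := S.existsUnique_freeUnder_hom _ K.isOrthogonalObject
  have hfg : f ≫ g = 𝟙 _ := (K.existsUnique_hom _ K.isOrthogonalObject).unique trivial trivial
  have hgf : g ≫ f = 𝟙 _ := (S.existsUnique_freeUnder_hom _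
    S.isOrthogonalObject_freeUnder).unique trivial trivial
  have hbij : Function.Bijective g.right.toFunctor.obj :=
    Function.bijective_iff_has_inverse.2 ⟨f.right.toFunctor.obj,
      fun x => congrArg (fun t => t.right.toFunctor.obj x) hgf,
      fun x => congrArg (fun t => t.right.toFunctor.obj x) hfg⟩
  have h : Free.ι S ⋙ g.right.toFunctor = K.lam :=
    (congrArg (fun t => t.toFunctor) (Under.w g)).trans K.hom_toFunctor_eq_lam
  rw [← h]
  exact hbij.comp Free.bijective_ι_obj

theorem isRealized_push : (S.push K.lam K.bijective_lam_obj.surjective).IsRealized :=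
  (S.isRealized_push_iff _ _).2 K.lifts_lam

theorem existsUnique_functor {D : Cat.{u, u}} (F : S.carrier ⥤ D) (hF : S.Lifts F) :
    ∃! G : K.fibr ⥤ D, K.lam ⋙ G = F := by
  obtain ⟨f, -, hf⟩ := K.existsUnique_hom (Under.mk F.toCatHom)
    ((S.isOrthogonalObject_generators_iff _).2 hF)
  refine ⟨f.right.toFunctor, ?_, fun G hG => ?_⟩
  · simp only [← hom_toFunctor_eq_lam]
    exact congrArg (fun t => t.toFunctor) (Under.w f)
  · rw [← hom_toFunctor_eq_lam] at hG
    exact congrArg (fun t => t.right.toFunctor)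
      (hf (Under.homMk G.toCatHom (Cat.Hom.ext hG)) trivial)

/-- The realized sketch `(fibr(E), {λ_!(E)(C_α)})`. -/
def realization : RealizedLimitSketch.{u} :=
  ⟨S.push K.lam K.bijective_lam_obj.surjective, K.isRealized_push⟩

/-- The map `(λ_!(E), id)`. -/
def unit : S ⟶ forgetRealized.{u}.obj K.realization :=
  S.toPush K.lam K.bijective_lam_obj.surjective

theorem bijective_unit_comp (R : RealizedLimitSketch.{u}) :
    Function.Bijective fun f : K.realization ⟶ R => K.unit ≫ forgetRealized.{u}.map f := by
  constructor
  · intro f g h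
    have h₁ : K.lam ⋙ Hom.functor f.hom = K.lam ⋙ Hom.functor g.hom :=
      congrArg (fun t : S ⟶ forgetRealized.{u}.obj R => Hom.functor (S := S) t) h
    have h₂ : Hom.onIndex f.hom = Hom.onIndex g.hom :=
      congrArg (fun t : S ⟶ forgetRealized.{u}.obj R => Hom.onIndex (S := S) t) h
    have hl : S.Lifts (K.lam ⋙ Hom.functor f.hom) :=
      R.property.lifts_functor (K.unit ≫ forgetRealized.{u}.map f)
    refine ObjectProperty.hom_ext _ (Hom.ext ?_ h₂)
    exact (K.existsUnique_functor _ hl).unique rfl h₁.symm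
  · intro g
    obtain ⟨G, hG, -⟩ := K.existsUnique_functor (Hom.functor g) (R.property.lifts_functor g)
    refine ⟨ObjectProperty.homMk (Hom.mk G (Hom.onIndex (S := S) g) fun a => ?_), Hom.ext hG rfl⟩
    -- The cones of the realization are images under `K.lam`, so `G` acts on them as `g` acts on the
    -- cones of `S`.
    refine Eq.trans ?_ (Hom.map_cone g a)
    exact congrArg (fun t => (S.cone a).map t) hG

theorem unit_comp_eqToHom {R : RealizedLimitSketch.{u}} (K : R.obj.FibrantReplacement)
    (hK : K.Z = Under.mk (𝟙 R.obj.carrier)) :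
    ∃ h : K.realization = R, K.unit ≫ forgetRealized.{u}.map (eqToHom h) = 𝟙 R.obj := by
  have key : ∀ (Z : Under R.obj.carrier) (i : Under.mk (𝟙 R.obj.carrier) ⟶ Z)
      (hs : Function.Surjective i.right.toFunctor.obj)
      (hr : (R.obj.push i.right.toFunctor hs).IsRealized), Z = Under.mk (𝟙 R.obj.carrier) →
      ∃ h : (⟨R.obj.push i.right.toFunctor hs, hr⟩ : RealizedLimitSketch.{u}) = R,
        (R.obj.toPush i.right.toFunctor hs :
          R.obj ⟶ forgetRealized.{u}.obj ⟨R.obj.push i.right.toFunctor hs, hr⟩) ≫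
          forgetRealized.{u}.map (eqToHom h) = 𝟙 R.obj := by
    rintro _ i hs hr rfl
    -- After substitution `i` is an endomorphism of the initial object `1_E`.
    obtain rfl : i = 𝟙 _ := Under.mkIdInitial.hom_ext _ _
    exact ⟨rfl, rfl⟩
  exact key K.Z K.i _ K.isRealized_push hK

end FibrantReplacement

/-! ### The adjunction, its unit and its counit -/

section Adjunction

variable (K : ∀ S : LimitSketch.{u}, S.FibrantReplacement)

/-- Maps out of the realization correspond to maps out of the sketch. -/
noncomputable def realizationHomEquiv (S : LimitSketch.{u}) (R : RealizedLimitSketch.{u}) :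
    ((K S).realization ⟶ R) ≃ (S ⟶ forgetRealized.{u}.obj R) :=
  Equiv.ofBijective _ ((K S).bijective_unit_comp R)

theorem realizationHomEquiv_comp (S : LimitSketch.{u}) (R R' : RealizedLimitSketch.{u})
    (g : R ⟶ R') (h : (K S).realization ⟶ R) :
    realizationHomEquiv K S R' (h ≫ g) =
      realizationHomEquiv K S R h ≫ forgetRealized.{u}.map g := rfl

/-- The left adjoint given by a choice of fibrant replacements. -/
noncomputable def realizationFunctor : LimitSketch.{u} ⥤ RealizedLimitSketch.{u} :=
  Adjunction.leftAdjointOfEquiv (realizationHomEquiv K) (realizationHomEquiv_comp K)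

/-- Realization is left adjoint to the forgetful functor. -/
noncomputable def realizationAdjunction : realizationFunctor K ⊣ forgetRealized.{u} :=
  Adjunction.adjunctionOfEquivLeft (realizationHomEquiv K) (realizationHomEquiv_comp K)

theorem realizationAdjunction_unit_app (S : LimitSketch.{u}) :
    (realizationAdjunction K).unit.app S = (K S).unit :=
  (Adjunction.adjunctionOfEquivLeft_unit_app _ _ _).trans
    (Category.comp_id (X := S) (Y := forgetRealized.{u}.obj (K S).realization) (K S).unit)

/-- By a triangle identity the counit and `eqToHom` both compose with the unit to the identity, and
composition with the unit is injective. -/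
theorem realizationAdjunction_counit_app (hK : IsNormalizedReplacement K)
    (R : RealizedLimitSketch.{u}) :
    ∃ hR : (realizationFunctor K).obj (forgetRealized.{u}.obj R) = R,
      (realizationAdjunction K).counit.app R = eqToHom hR := by
  obtain ⟨h, hu⟩ := FibrantReplacement.unit_comp_eqToHom (K R.obj) (hK R.obj R.property)
  refine ⟨h, ((K R.obj).bijective_unit_comp R).1 (Eq.trans ?_ hu.symm)⟩
  have := (realizationAdjunction K).right_triangle_components R
  rw [realizationAdjunction_unit_app] at this
  exact this

end Adjunction

end LimitSketch

open LimitSketch in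
theorem mainTheorem1 :
    -- fibrant replacements exist, and can be taken trivial on realized sketches
    (∃ K : ∀ S : LimitSketch.{u}, S.FibrantReplacement, IsNormalizedReplacement K) ∧
    -- any choice of them yields the left adjoint
    ∀ K : ∀ S : LimitSketch.{u}, S.FibrantReplacement,
      ∃ (hbij : ∀ S, Function.Bijective (K S).lam.obj)
        (hreal : ∀ S, (S.push (K S).lam (hbij S).surjective).IsRealized)
        (Fr : LimitSketch.{u} ⥤ RealizedLimitSketch.{u})
        (hobj : ∀ S, Fr.obj S = ⟨S.push (K S).lam (hbij S).surjective, hreal S⟩)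
        (adj : Fr ⊣ forgetRealized.{u}),
        (∀ S, adj.unit.app S ≫ eqToHom (congrArg forgetRealized.{u}.obj (hobj S)) =
          S.toPush (K S).lam (hbij S).surjective) ∧
        (∀ R : RealizedLimitSketch.{u}, IsIso (adj.counit.app R)) ∧
        (IsNormalizedReplacement K → ∀ R : RealizedLimitSketch.{u},
          ∃ hR : Fr.obj (forgetRealized.{u}.obj R) = R, adj.counit.app R = eqToHom hR) := by
  refine ⟨exists_normalized_replacement, fun K => ⟨fun S => (K S).bijective_lam_obj,
    fun S => (K S).isRealized_push, realizationFunctor K, fun _ => rfl, realizationAdjunction K,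
    -- The counit is invertible because the right adjoint is the inclusion of a full subcategory.
    fun S => ?_, fun R => inferInstance, realizationAdjunction_counit_app K⟩⟩
  rw [realizationAdjunction_unit_app]
  exact Category.comp_id _
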